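/- Consider a Nash equilibrium problem with $N$ players and canonical perturbations. Given the strategies $x^{-k}$ of the other players, player $k$ solves $$\min_{x^k\in\mathbb{R}^{n_k}} f^k(x^k,x^{-k};w^k)-\langle v^k,x^k\rangle\quad\text{s.t.}\quad g^k_i(x^k;w^k)=u^k_i\ (i=1,\dots,s_k),\qquad g^k_j(x^k;w^k)\le u^k_j\ (j=s_k+1,\dots,m_k),$$ where $f^k\in C^2(\mathbb{R}^{n}\times\mathbb{R}^{d_k})$ with $n=n_1+\dots+n_N$, $g^k_i\in C^2(\mathbb{R}^{n_k}\times\mathbb{R}^{d_k})$, and $p^k=(u^k,v^k,w^k)\in\mathbb{R}^{m_k}\times\mathbb{R}^{n_k}\times\mathbb{R}^{d_k}$, $p=(p^1,\dots,p^N)$ are the perturbation parameters. Let $G^k=(g^k_1,\dots,g^k_{m_k})$ and $L^k(x^k,x^{-k},\lambda^k;w^k)=f^k(x^k,x^{-k};w^k)+\sum_{i=1}^{m_k}\lambda^k_i g^k_i(x^k;w^k)$. Let $S_{\rm KKT}(p)$ be the set of all $(x,\lambda)=(x^1,\dots,x^N,\lambda^1,\dots,\lambda^N)$ such that for every $k$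 $$v^k=\nabla_{x^k}L^k(x^k,x^{-k},\lambda^k;w^k),\qquad -u^k\in -G^k(x^k;w^k)+N_{\mathbb{R}^{s_k}\times\mathbb{R}_+^{m_k-s_k}}(\lambda^k),$$ where $N_C(\cdot)$ denotes the normal cone to $C$ (empty at points outside $C$). Let $(\bar x,\bar\lambda)\in S_{\rm KKT}(\bar p)$, and for each $k$ put $$I^k_1=\{1,\dots,s_k\}\cup\{i>s_k:\ \bar\lambda^k_i>0=g^k_i(\bar x^k;\bar w^k)-\bar u^k_i\},\qquad I^k_2=\{i>s_k:\ \bar\lambda^k_i=0=g^k_i(\bar x^k;\bar w^k)-\bar u^k_i\},$$ $$K(I_1,I_2)=\Big\{y=(y^1,\dots,y^N)\in\mathbb{R}^n:\ \nabla_{x^k}g^k_i(\bar x^k;\bar w^k)^{\mathrm T}y^k=0\ (i\in I^k_1),\ \ \nabla_{x^k}g^k_i(\bar x^k;\bar w^k)^{\mathrm T}y^k\le 0\ (i\in I^k_2),\ \ k=1,\dots,N\Big\}.$$ **Theorem.** Suppose that i) for each player $k$ the strict Mangasarian–Fromovitz constraint qualification (SMFCQ) holds at $(\bar p^k,\bar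 x^k,\bar\lambda^k)$: the vectors $\nabla_{x^k}g^k_i(\bar x^k;\bar w^k)$, $i\in I^k_1$, are linearly independent, and there is $z\in\mathbb{R}^{n_k}$ with $\nabla_{x^k}g^k_i(\bar x^k;\bar w^k)^{\mathrm T}z=0$ for all $i\in I^k_1$ and $\nabla_{x^k}g^k_i(\bar x^k;\bar w^k)^{\mathrm T}z<0$ for all $i\in I^k_2$; ii) the problem satisfies the I-property at $(\bar p,\bar x,\bar\lambda)$ on $K(I_1,I_2)$: if $y\in K(I_1,I_2)$ and $\sum_{i=1}^N (y^k)^{\mathrm T}\nabla^2_{x^kx^i}L^k(\bar x^k,\bar x^{-k},\bar\lambda^k;\bar w^k)\,y^i=0$ for every $k=1,\dots,N$, then $y=0$. Then $S_{\rm KKT}$ is isolatedly calm at $\bar p$ for $(\bar x,\bar\lambda)$: $(\bar x,\bar\lambda)\in S_{\rm KKT}(\bar p)$, and there are a constant $\kappa\ge 0$ and open neighborhoods $U$ of $\bar p$ and $V$ of $(\bar x,\bar\lambda)$ such that $$S_{\rm KKT}(p)\cap V\subset\{(\bar x,\bar\lambda)\}+\kappa\|p-\bar p\|\,\mathbb{B}\qquad\text{for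 all }p\in U,$$ where $\mathbb{B}$ is the unit ball. -/

import Mathlib

open scoped Pointwise InnerProductSpace

noncomputable section

/-- A set-valued mapping `Φ : X ⇉ Y` is isolated calm at `a` for `b` if `b ∈ Φ a` and there are a
constant `κ ≥ 0` and open neighborhoods `U` of `a` and `V` of `b` such that
`Φ a' ∩ V ⊆ {b} + κ ‖a' - a‖ 𝔹` for all `a' ∈ U`, where `𝔹` is the unit ball of `Y`. -/
def IsolatedCalm {X Y : Type*} [NormedAddCommGroup X] [NormedAddCommGroup Y] [NormedSpace ℝ Y]
    (Φ : X → Set Y) (a : X) (b : Y) : Prop :=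
  b ∈ Φ a ∧ ∃ κ : ℝ, 0 ≤ κ ∧ ∃ U : Set X, ∃ V : Set Y,
    IsOpen U ∧ a ∈ U ∧ IsOpen V ∧ b ∈ V ∧
    ∀ a' ∈ U, Φ a' ∩ V ⊆ {b} + (κ * ‖a' - a‖) • Metric.closedBall (0 : Y) 1

/-- `v` is a regular normal to `C` at `a ∈ C`: `⟪v, y - a⟫ ≤ o(‖y - a‖)` for `y ∈ C`. -/
def regularNormalCone {E : Type*} [NormedAddCommGroup E] [InnerProductSpace ℝ E]
    (C : Set E) (a : E) : Set E :=
  {v | a ∈ C ∧ ∀ ε : ℝ, 0 < ε → ∃ δ : ℝ, 0 < δ ∧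
    ∀ y ∈ C, ‖y - a‖ < δ → ⟪v, y - a⟫_ℝ ≤ ε * ‖y - a‖}

/-- The (limiting) normal cone of variational analysis to `C` at `a`: limits of regular normals
`v l` at points `z l ∈ C` with `z l → a`. It is empty if `a ∉ C`. For convex `C` it is
the normal cone of convex analysis. -/
def normalCone {E : Type*} [NormedAddCommGroup E] [InnerProductSpace ℝ E]
    (C : Set E) (a : E) : Set E :=
  {v | a ∈ C ∧ ∃ (z : ℕ → E) (ν : ℕ → E), (∀ l, ν l ∈ regularNormalCone C (z l)) ∧
    Filter.Tendsto z Filter.atTop (nhds a) ∧ Filter.Tendsto ν Filter.atTop (nhds v)}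

/-- The data of a Nash equilibrium problem with `N` players and canonical perturbations. Player `k`
has a strategy in `ℝ^(n k)`, a perturbation parameter `w^k ∈ ℝ^(d k)`, a `C²` objective
`f k (x; w^k)` depending on the strategies `x` of all players, and `m k` constraint functions
`g k i (x^k; w^k)` of class `C²`, the first `s k` of which are equality constraints. -/
structure NEP (N : ℕ) where
  n : Fin N → ℕ
  m : Fin N → ℕ
  s : Fin N → ℕ
  d : Fin N → ℕ
  s_le_m : ∀ k, s k ≤ m k
  f : ∀ k, (∀ j, EuclideanSpace ℝ (Fin (n j))) → EuclideanSpace ℝ (Fin (d k)) → ℝ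
  g : ∀ k, Fin (m k) → EuclideanSpace ℝ (Fin (n k)) → EuclideanSpace ℝ (Fin (d k)) → ℝ
  f_contDiff : ∀ k, ContDiff ℝ 2
    (fun z : (∀ j, EuclideanSpace ℝ (Fin (n j))) × EuclideanSpace ℝ (Fin (d k)) => f k z.1 z.2)
  g_contDiff : ∀ k i, ContDiff ℝ 2
    (fun z : EuclideanSpace ℝ (Fin (n k)) × EuclideanSpace ℝ (Fin (d k)) => g k i z.1 z.2)

namespace NEP

variable {N : ℕ} (P : NEP N)

/-- Strategy profiles `x = (x^1, ..., x^N)`. Finite products carry the maximum of the Euclidean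
norms of their factors, which is equivalent to the Euclidean norm. -/
abbrev Strategy : Type := ∀ k, EuclideanSpace ℝ (Fin (P.n k))

/-- Multiplier profiles `λ = (λ^1, ..., λ^N)`. -/
abbrev Multiplier : Type := ∀ k, EuclideanSpace ℝ (Fin (P.m k))

/-- Perturbation parameters `p^k = (u^k, v^k, w^k)` of player `k`. -/
abbrev PlayerParam (k : Fin N) : Type :=
  EuclideanSpace ℝ (Fin (P.m k)) × EuclideanSpace ℝ (Fin (P.n k)) × EuclideanSpace ℝ (Fin (P.d k))

/-- Perturbation parameters `p = (p^1, ..., p^N)`. -/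
abbrev Param : Type := ∀ k, P.PlayerParam k

/-- The component `u^k` of `p^k = (u^k, v^k, w^k)`. -/
abbrev uPart {P : NEP N} {k : Fin N} (pk : P.PlayerParam k) : EuclideanSpace ℝ (Fin (P.m k)) :=
  pk.1

/-- The component `v^k` of `p^k = (u^k, v^k, w^k)`. -/
abbrev vPart {P : NEP N} {k : Fin N} (pk : P.PlayerParam k) : EuclideanSpace ℝ (Fin (P.n k)) :=
  pk.2.1

/-- The component `w^k` of `p^k = (u^k, v^k, w^k)`. -/
abbrev wPart {P : NEP N} {k : Fin N} (pk : P.PlayerParam k) : EuclideanSpace ℝ (Fin (P.d k)) :=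
  pk.2.2

/-- The constraint map `G^k(x^k; w^k) = (g^k_1, ..., g^k_{m_k})`. -/
def G (k : Fin N) (xk : EuclideanSpace ℝ (Fin (P.n k))) (wk : EuclideanSpace ℝ (Fin (P.d k))) :
    EuclideanSpace ℝ (Fin (P.m k)) :=
  WithLp.toLp 2 (fun i => P.g k i xk wk)

/-- The ordinary Lagrange function `L^k(x^k, x^{-k}, λ^k; w^k)`. -/
def lagrangian (k : Fin N) (x : P.Strategy) (lamk : EuclideanSpace ℝ (Fin (P.m k)))
    (wk : EuclideanSpace ℝ (Fin (P.d k))) : ℝ :=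
  P.f k x wk + ∑ i, lamk i * P.g k i (x k) wk

/-- The partial gradient `∇_{x^k} L^k(x^k, x^{-k}, λ^k; w^k)`. -/
def gradLagrangian (k : Fin N) (x : P.Strategy) (lamk : EuclideanSpace ℝ (Fin (P.m k)))
    (wk : EuclideanSpace ℝ (Fin (P.d k))) : EuclideanSpace ℝ (Fin (P.n k)) :=
  gradient (fun z => P.lagrangian k (Function.update x k z) lamk wk) (x k)

/-- The block `∇²_{x^k x^i} L^k(x^k, x^{-k}, λ^k; w^k)`, an `n_k × n_i` matrix regarded as a linear
map: the partial derivative of `∇_{x^k} L^k` with respect to `x^i`. -/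
def hessLagrangian (k i : Fin N) (x : P.Strategy) (lamk : EuclideanSpace ℝ (Fin (P.m k)))
    (wk : EuclideanSpace ℝ (Fin (P.d k))) :
    EuclideanSpace ℝ (Fin (P.n i)) →L[ℝ] EuclideanSpace ℝ (Fin (P.n k)) :=
  fderiv ℝ (fun z => P.gradLagrangian k (Function.update x i z) lamk wk) (x i)

/-- The gradient `∇_{x^k} g^k_i(x^k; w^k)`. -/
def gradConstraint (k : Fin N) (i : Fin (P.m k)) (xk : EuclideanSpace ℝ (Fin (P.n k)))
    (wk : EuclideanSpace ℝ (Fin (P.d k))) : EuclideanSpace ℝ (Fin (P.n k)) :=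
  gradient (fun z => P.g k i z wk) xk

/-- The set `ℝ^{s_k} × ℝ_+^{m_k - s_k}`. -/
def multiplierSet (k : Fin N) : Set (EuclideanSpace ℝ (Fin (P.m k))) :=
  {lamk | ∀ i : Fin (P.m k), P.s k ≤ i.val → 0 ≤ lamk i}

/-- The KKT solution mapping: `S_KKT p` is the set of all `(x, λ)` such that, for every player `k`,
`v^k = ∇_{x^k} L^k(x, λ^k; w^k)` and `-u^k ∈ -G^k(x^k; w^k) + N(λ^k)`, where `N(λ^k)` is the
normal cone to `ℝ^{s_k} × ℝ_+^{m_k - s_k}` at `λ^k`. -/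
def SKKT (p : P.Param) : Set (P.Strategy × P.Multiplier) :=
  {z | ∀ k, vPart (p k) = P.gradLagrangian k z.1 (z.2 k) (wPart (p k)) ∧
    -uPart (p k) ∈
      ({-P.G k (z.1 k) (wPart (p k))} : Set (EuclideanSpace ℝ (Fin (P.m k)))) +
        normalCone (P.multiplierSet k) (z.2 k)}

/-- The index set `I^k_1`: equality constraints and strongly active inequality constraints.
Indices are counted from `0`, so the equality constraints are those with `i < s_k`. -/
def I₁ (k : Fin N) (pk : P.PlayerParam k) (xk : EuclideanSpace ℝ (Fin (P.n k)))
    (lamk : EuclideanSpace ℝ (Fin (P.m k))) : Set (Fin (P.m k)) :=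
  {i | P.s k ≤ i.val ∧ 0 < lamk i ∧ P.g k i xk (wPart pk) - uPart pk i = 0} ∪
    {i | i.val < P.s k}

/-- The index set `I^k_2`: active inequality constraints with zero multiplier. -/
def I₂ (k : Fin N) (pk : P.PlayerParam k) (xk : EuclideanSpace ℝ (Fin (P.n k)))
    (lamk : EuclideanSpace ℝ (Fin (P.m k))) : Set (Fin (P.m k)) :=
  {i | P.s k ≤ i.val ∧ lamk i = 0 ∧ P.g k i xk (wPart pk) - uPart pk i = 0}

/-- The strict Mangasarian-Fromovitz constraint qualification for player `k` at
`(p^k, x^k, λ^k)`. -/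
def SMFCQ (k : Fin N) (pk : P.PlayerParam k) (xk : EuclideanSpace ℝ (Fin (P.n k)))
    (lamk : EuclideanSpace ℝ (Fin (P.m k))) : Prop :=
  LinearIndependent ℝ
    (fun i : P.I₁ k pk xk lamk => P.gradConstraint k (i : Fin (P.m k)) xk (wPart pk)) ∧
  ∃ y : EuclideanSpace ℝ (Fin (P.n k)),
    (∀ i ∈ P.I₁ k pk xk lamk, ⟪P.gradConstraint k i xk (wPart pk), y⟫_ℝ = 0) ∧
    (∀ i ∈ P.I₂ k pk xk lamk, ⟪P.gradConstraint k i xk (wPart pk), y⟫_ℝ < 0)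

/-- The cone `K(J_1, J_2)` at `(p, x)`. -/
def K (p : P.Param) (x : P.Strategy) (J₁ J₂ : ∀ k, Set (Fin (P.m k))) : Set P.Strategy :=
  {y | ∀ k,
    (∀ i ∈ J₁ k, ⟪P.gradConstraint k i (x k) (wPart (p k)), y k⟫_ℝ = 0) ∧
    (∀ i ∈ J₂ k, ⟪P.gradConstraint k i (x k) (wPart (p k)), y k⟫_ℝ ≤ 0)}

/-- The I-property at `(p, x, λ)` on a set `C` of directions. -/
def IPropertyOn (p : P.Param) (x : P.Strategy) (lam : P.Multiplier) (C : Set P.Strategy) : Prop :=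
  ∀ y ∈ C,
    (∀ k, ∑ i, ⟪y k, P.hessLagrangian k i x (lam k) (wPart (p k)) (y i)⟫_ℝ = 0) → y = 0

end NEP

end

open Filter Topology

/-! If isolated calmness fails, there are KKT points z_l → z̄ for parameters p_l → p̄ with ‖p_l -
p̄‖ = o(‖z_l - z̄‖). The quotients (z_l - z̄)/‖z_l - z̄‖ then have a cluster point η = (y, μ) of
norm one, and `isolatedCalm_of_forall_tangent_eq_zero` reduces the theorem to η = 0.

Since the parameter differences vanish at this scale, η solves the KKT system linearized in (x, λ)
alone: ∑_i ∇²_{x^k x^i}L^k y^i + ∑_i μ^k_i ∇g^k_i = 0 for every k (`linearized_gradient_eq_zero`).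
By `linearized_complementarity`, ∇g^k_i·y^k = 0 on I₁; on I₂, ∇g^k_i·y^k ≤ 0 ≤ μ^k_i with one of the
two zero; elsewhere μ^k_i = 0. Hence y ∈ K(I₁, I₂), and pairing the k-th equation with y^k kills the
multiplier term. The I-property gives y = 0. What remains is ∑_i μ^k_i ∇g^k_i = 0, and
`SMFCQ.eq_zero` gives μ = 0. -/

/-! ### Isolated calmness and tangent directions -/

/-- A criterion for isolated calmness in terms of tangent directions of the graph. -/
theorem isolatedCalm_of_forall_tangent_eq_zero {X Y : Type*} [NormedAddCommGroup X]
    [NormedSpace ℝ X] [NormedAddCommGroup Y] [NormedSpace ℝ Y] [FiniteDimensional ℝ Y]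
    {Φ : X → Set Y} {a : X} {b : Y} (hb : b ∈ Φ a)
    (h : ∀ (𝒰 : Ultrafilter ℕ) (p : ℕ → X) (z : ℕ → Y) (c : ℕ → ℝ) (η : Y),
      (∀ l, 0 < c l) → (∀ l, z l ∈ Φ (p l)) → Tendsto p 𝒰 (𝓝 a) → Tendsto z 𝒰 (𝓝 b) →
      Tendsto (fun l => c l • (p l - a)) 𝒰 (𝓝 0) →
      Tendsto (fun l => c l • (z l - b)) 𝒰 (𝓝 η) → η = 0) :
    IsolatedCalm Φ a b := by
  refine ⟨hb, ?_⟩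
  by_contra hcon
  -- Negated calmness with κ = l + 1 on balls of radius 1/(l + 1).
  have key : ∀ l : ℕ, ∃ q : X × Y, q.2 ∈ Φ q.1 ∧ ‖q.1 - a‖ < 1 / ((l : ℝ) + 1) ∧
      ‖q.2 - b‖ < 1 / ((l : ℝ) + 1) ∧ ((l : ℝ) + 1) * ‖q.1 - a‖ < ‖q.2 - b‖ := by
    intro l
    by_contra hl
    push Not at hl
    have hl0 : (0 : ℝ) < (l : ℝ) + 1 := by positivity
    have hpos : (0 : ℝ) < 1 / ((l : ℝ) + 1) := by positivity
    refine hcon ⟨(l : ℝ) + 1, hl0.le, Metric.ball a (1 / ((l : ℝ) + 1)),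
      Metric.ball b (1 / ((l : ℝ) + 1)), Metric.isOpen_ball, Metric.mem_ball_self hpos,
      Metric.isOpen_ball, Metric.mem_ball_self hpos, ?_⟩
    rintro p hp z ⟨hz, hzb⟩
    rw [smul_unitClosedBall_of_nonneg (by positivity)]
    refine Set.mem_add.2 ⟨b, rfl, z - b, ?_, by abel⟩
    rw [mem_closedBall_zero_iff]
    exact hl (p, z) hz (by simpa [dist_eq_norm] using hp) (by simpa [dist_eq_norm] using hzb)
  choose q hq hqa hqb hqc using key
  have hle : (hyperfilter ℕ : Filter ℕ) ≤ atTop := Nat.hyperfilter_le_atTop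
  have hlim : Tendsto (fun l : ℕ => 1 / ((l : ℝ) + 1)) (hyperfilter ℕ : Filter ℕ) (𝓝 0) :=
    tendsto_one_div_add_atTop_nhds_zero_nat.mono_left hle
  have hpos : ∀ l, 0 < ‖(q l).2 - b‖ := fun l =>
    lt_of_le_of_lt (by positivity) (hqc l)
  have hnorm : ∀ l, ‖‖(q l).2 - b‖⁻¹ • ((q l).2 - b)‖ = 1 := fun l => by
    rw [norm_smul, norm_inv, norm_norm, inv_mul_cancel₀ (hpos l).ne']
  have : ProperSpace Y := FiniteDimensional.proper ℝ Y
  -- Compactness of the unit sphere; the ultrafilter replaces passing to subsequences.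
  obtain ⟨η, hη, hηlim⟩ := (isCompact_sphere (0 : Y) 1).ultrafilter_le_nhds
    ((hyperfilter ℕ).map fun l => ‖(q l).2 - b‖⁻¹ • ((q l).2 - b))
    (by
      rw [le_principal_iff]
      exact Ultrafilter.mem_coe.1 (Filter.univ_mem' (f := (hyperfilter ℕ : Filter ℕ)) fun l => by simpa using hnorm l))
  have hη0 := h (hyperfilter ℕ) (fun l => (q l).1) (fun l => (q l).2)
    (fun l => ‖(q l).2 - b‖⁻¹) η (fun l => inv_pos.2 (hpos l)) hq
    (tendsto_iff_norm_sub_tendsto_zero.2 (squeeze_zero (fun _ => norm_nonneg _)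
      (fun l => (hqa l).le) hlim))
    (tendsto_iff_norm_sub_tendsto_zero.2 (squeeze_zero (fun _ => norm_nonneg _)
      (fun l => (hqb l).le) hlim))
    (squeeze_zero_norm (fun l => by
      have hl0 : (0 : ℝ) < (l : ℝ) + 1 := by positivity
      rw [norm_smul, norm_inv, norm_norm, inv_mul_le_iff₀ (hpos l), mul_one_div,
        le_div_iff₀ hl0, mul_comm]
      exact (hqc l).le) hlim) hηlim
  simp [hη0] at hη

/-- First-order expansion of a differentiable map along a convergent family of difference
quotients. -/
theorem HasFDerivAt.tendsto_smul_sub {E F : Type*} [NormedAddCommGroup E] [NormedSpace ℝ E]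
    [NormedAddCommGroup F] [NormedSpace ℝ F] {f : E → F} {f' : E →L[ℝ] F} {x : E}
    (hf : HasFDerivAt f f' x) {α : Type*} {l : Filter α} {c : α → ℝ} {d : α → E} {v : E}
    (hd : Tendsto d l (𝓝 x)) (hcd : Tendsto (fun n => c n • (d n - x)) l (𝓝 v)) :
    Tendsto (fun n => c n • (f (d n) - f x)) l (𝓝 (f' v)) := by
  have := (hasFDerivWithinAt_univ.2 hf).lim (d := fun n => d n - x)
    (by simpa using hd.sub_const x) (.of_forall fun _ => Set.mem_univ _) hcd
  simpa using this

/-! ### Normal cones and complementarity -/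

/-- A positive slope ⟪v, e⟫ along a segment inside C would contradict the o(‖y - a‖) bound. -/
theorem inner_nonpos_of_mem_regularNormalCone {E : Type*} [NormedAddCommGroup E]
    [InnerProductSpace ℝ E] {C : Set E} {a v e : E} (hv : v ∈ regularNormalCone C a)
    {r : ℝ} (hr : 0 < r) (he : ∀ h : ℝ, 0 < h → h < r → a + h • e ∈ C) : ⟪v, e⟫_ℝ ≤ 0 := by
  by_contra hcon
  push Not at hcon
  have hn : 0 < ‖e‖ := by
    rw [norm_pos_iff]
    rintro rfl
    simp at hcon
  -- This ε allows only half of the slope along e: h⟪v, e⟫ ≤ h⟪v, e⟫/2.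
  obtain ⟨δ, hδ, H⟩ := hv.2 (⟪v, e⟫_ℝ / (2 * ‖e‖)) (by positivity)
  obtain ⟨h, h0, h1⟩ := exists_between (lt_min hr (div_pos hδ hn))
  have h2 : h * ‖e‖ < δ := by
    rw [← lt_div_iff₀ hn]
    exact h1.trans_le (min_le_right _ _)
  have := H (a + h • e) (he h h0 (h1.trans_le (min_le_left _ _)))
    (by simpa [norm_smul, abs_of_pos h0] using h2)
  rw [add_sub_cancel_left, inner_smul_right, norm_smul, Real.norm_of_nonneg h0.le] at this
  have h3 : ⟪v, e⟫_ℝ / (2 * ‖e‖) * (h * ‖e‖) = h * ⟪v, e⟫_ℝ / 2 := by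
    field_simp
  rw [h3] at this
  nlinarith [mul_pos h0 hcon]

namespace NEP

variable {N : ℕ} {P : NEP N} {k : Fin N}

theorem apply_nonpos_of_mem_regularNormalCone {lam v : EuclideanSpace ℝ (Fin (P.m k))}
    (hv : v ∈ regularNormalCone (P.multiplierSet k) lam) (i : Fin (P.m k)) : v i ≤ 0 := by
  have := inner_nonpos_of_mem_regularNormalCone (e := EuclideanSpace.single i (1 : ℝ)) hv one_pos
    (fun h h0 _ j hj => by
      have h1 : 0 ≤ lam j := hv.1 j hj
      by_cases hij : j = i
      · subst hij
        simpa using add_nonneg h1 h0.le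
      · simpa [hij] using h1)
  simpa [EuclideanSpace.inner_single_right] using this

theorem apply_eq_zero_of_mem_regularNormalCone {lam v : EuclideanSpace ℝ (Fin (P.m k))}
    (hv : v ∈ regularNormalCone (P.multiplierSet k) lam) {i : Fin (P.m k)}
    (hi : i.val < P.s k ∨ 0 < lam i) : v i = 0 := by
  refine le_antisymm (apply_nonpos_of_mem_regularNormalCone hv i) ?_
  -- Room to move along -e_i inside the set: any step if coordinate i is free, up to `lam i`
  -- otherwise.
  obtain ⟨r, hr, hr'⟩ : ∃ r : ℝ, 0 < r ∧ (P.s k ≤ i.val → r ≤ lam i) := by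
    rcases hi with hi | hi
    · exact ⟨1, one_pos, fun h => absurd h (not_le.2 hi)⟩
    · exact ⟨lam i, hi, fun _ => le_rfl⟩
  have := inner_nonpos_of_mem_regularNormalCone (e := EuclideanSpace.single i (-1 : ℝ)) hv hr
    (fun h _ h0 j hj => by
      have h1 : 0 ≤ lam j := hv.1 j hj
      by_cases hij : j = i
      · subst hij
        have := hr' hj
        simp
        linarith
      · simpa [hij] using h1)
  simpa [EuclideanSpace.inner_single_right] using this

theorem apply_nonpos_of_mem_normalCone {lam v : EuclideanSpace ℝ (Fin (P.m k))}
    (hv : v ∈ normalCone (P.multiplierSet k) lam) (i : Fin (P.m k)) : v i ≤ 0 := by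
  obtain ⟨-, z, ν, hν, -, hνv⟩ := hv
  exact le_of_tendsto (((EuclideanSpace.proj (𝕜 := ℝ) i).continuous.tendsto v).comp hνv)
    (.of_forall fun l => apply_nonpos_of_mem_regularNormalCone (hν l) i)

theorem apply_eq_zero_of_mem_normalCone {lam v : EuclideanSpace ℝ (Fin (P.m k))}
    (hv : v ∈ normalCone (P.multiplierSet k) lam) {i : Fin (P.m k)}
    (hi : i.val < P.s k ∨ 0 < lam i) : v i = 0 := by
  obtain ⟨-, z, ν, hν, hz, hνv⟩ := hv
  have hz' : Tendsto (fun l => z l i) atTop (𝓝 (lam i)) :=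
    ((EuclideanSpace.proj (𝕜 := ℝ) i).continuous.tendsto lam).comp hz
  have hν' : Tendsto (fun l => ν l i) atTop (𝓝 (v i)) :=
    ((EuclideanSpace.proj (𝕜 := ℝ) i).continuous.tendsto v).comp hνv
  -- Positivity of coordinate i is open, so it passes to the nearby base points of the regular
  -- normals.
  have hev : ∀ᶠ l in atTop, i.val < P.s k ∨ 0 < z l i := by
    rcases hi with hi | hi
    · exact .of_forall fun _ => .inl hi
    · exact (hz'.eventually_const_lt hi).mono fun _ => .inr
  exact tendsto_nhds_unique_of_eventuallyEq hν' tendsto_const_nhds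
    (hev.mono fun l hl => apply_eq_zero_of_mem_regularNormalCone (hν l) hl)

/-- The constraint part of the KKT system in complementarity form. -/
theorem constraints_of_mem_SKKT {p : P.Param} {z : P.Strategy × P.Multiplier}
    (hz : z ∈ P.SKKT p) (k : Fin N) (i : Fin (P.m k)) :
    (P.s k ≤ i.val → 0 ≤ z.2 k i) ∧
      P.g k i (z.1 k) (wPart (p k)) - uPart (p k) i ≤ 0 ∧
      (i.val < P.s k ∨ 0 < z.2 k i → P.g k i (z.1 k) (wPart (p k)) - uPart (p k) i = 0) := by
  obtain ⟨a, rfl, v, hv, hav⟩ := Set.mem_add.1 (hz k).2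
  have hvi : v i = P.g k i (z.1 k) (wPart (p k)) - uPart (p k) i := by
    have := congrArg (fun w : EuclideanSpace ℝ (Fin (P.m k)) => w i) hav
    simp [G] at this
    linarith
  rw [← hvi]
  exact ⟨hv.1 i, apply_nonpos_of_mem_normalCone hv i, apply_eq_zero_of_mem_normalCone hv⟩

/-! ### Derivatives of the Lagrangian gradient and of the constraints -/

theorem contDiff_lagrangian (P : NEP N) (k : Fin N) :
    ContDiff ℝ 2 (fun c : P.Strategy × EuclideanSpace ℝ (Fin (P.m k)) ×
      EuclideanSpace ℝ (Fin (P.d k)) => P.lagrangian k c.1 c.2.1 c.2.2) := by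
  unfold lagrangian
  refine ContDiff.add ((P.f_contDiff k).comp (contDiff_fst.prodMk contDiff_snd.snd))
    (ContDiff.sum fun i _ => ContDiff.mul ?_ ?_)
  · exact (EuclideanSpace.proj (𝕜 := ℝ) i).contDiff.comp contDiff_snd.fst
  · exact (P.g_contDiff k i).comp (((ContinuousLinearMap.proj (R := ℝ)
      (φ := fun j => EuclideanSpace ℝ (Fin (P.n j))) k).contDiff.comp contDiff_fst).prodMk
        contDiff_snd.snd)

/-- Expresses the partial gradient through the joint derivative, from which its joint C¹ regularity
follows. -/
theorem gradLagrangian_eq_toDual_symm (x : P.Strategy) (lam : EuclideanSpace ℝ (Fin (P.m k)))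
    (w : EuclideanSpace ℝ (Fin (P.d k))) :
    P.gradLagrangian k x lam w = (InnerProductSpace.toDual ℝ _).symm
      ((fderiv ℝ (fun c : P.Strategy × EuclideanSpace ℝ (Fin (P.m k)) ×
        EuclideanSpace ℝ (Fin (P.d k)) => P.lagrangian k c.1 c.2.1 c.2.2) (x, lam, w)).comp
        ((ContinuousLinearMap.inl ℝ _ _).comp
          (ContinuousLinearMap.pi (Pi.single k (ContinuousLinearMap.id ℝ _))))) := by
  unfold gradLagrangian gradient
  congr 1
  have h1 := ((P.contDiff_lagrangian k).differentiable (by norm_num) (x, lam, w)).hasFDerivAt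
  have h2 := (hasFDerivAt_update (𝕜 := ℝ) x (x k)).prodMk
    (hasFDerivAt_const (lam, w) (x k))
  have h3 := HasFDerivAt.comp (x k) (by simpa using h1) h2
  refine h3.fderiv.trans ?_
  ext v
  simp

theorem contDiff_gradLagrangian (P : NEP N) (k : Fin N) :
    ContDiff ℝ 1 (fun c : P.Strategy × EuclideanSpace ℝ (Fin (P.m k)) ×
      EuclideanSpace ℝ (Fin (P.d k)) => P.gradLagrangian k c.1 c.2.1 c.2.2) := by
  simp only [gradLagrangian_eq_toDual_symm]
  refine (InnerProductSpace.toDual ℝ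
    (EuclideanSpace ℝ (Fin (P.n k)))).symm.toContinuousLinearEquiv.contDiff.comp ?_
  exact ((P.contDiff_lagrangian k).fderiv_right (by norm_num)).clm_comp contDiff_const

theorem differentiableAt_constraint (i : Fin (P.m k)) (x : EuclideanSpace ℝ (Fin (P.n k)))
    (w : EuclideanSpace ℝ (Fin (P.d k))) : DifferentiableAt ℝ (fun z => P.g k i z w) x :=
  ((P.g_contDiff k i).comp (contDiff_id.prodMk contDiff_const)).differentiable (by norm_num) x

theorem gradLagrangian_add_multiplier (x : P.Strategy) (lam μ : EuclideanSpace ℝ (Fin (P.m k)))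
    (w : EuclideanSpace ℝ (Fin (P.d k))) :
    P.gradLagrangian k x (lam + μ) w =
      P.gradLagrangian k x lam w + ∑ i, μ i • P.gradConstraint k i (x k) w := by
  have h1 : DifferentiableAt ℝ (fun z => P.lagrangian k (Function.update x k z) lam w) (x k) :=
    ((P.contDiff_lagrangian k).differentiable (by norm_num) _).comp (x k)
      ((hasFDerivAt_update (𝕜 := ℝ) x (x k)).differentiableAt.prodMk
        (differentiableAt_const (lam, w)))
  have h2 : HasFDerivAt (fun z => ∑ i, μ i • P.g k i z w)
      (∑ i, μ i • fderiv ℝ (fun z => P.g k i z w) (x k)) (x k) :=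
    HasFDerivAt.fun_sum fun i _ => (differentiableAt_constraint i (x k) w).hasFDerivAt.fun_const_smul _
  have h3 : (fun z => P.lagrangian k (Function.update x k z) (lam + μ) w) =
      fun z => P.lagrangian k (Function.update x k z) lam w + ∑ i, μ i • P.g k i z w := by
    ext z
    simp [lagrangian, add_mul, Finset.sum_add_distrib, add_assoc]
  unfold gradLagrangian gradConstraint gradient
  rw [h3, (h1.hasFDerivAt.fun_add h2).fderiv]
  simp [map_sum]

/-- The derivative of the gradient of the Lagrangian in the directions that leave the
parameter fixed. -/
theorem fderiv_gradLagrangian_apply (x : P.Strategy) (lam : EuclideanSpace ℝ (Fin (P.m k)))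
    (w : EuclideanSpace ℝ (Fin (P.d k))) (y : P.Strategy) (μ : EuclideanSpace ℝ (Fin (P.m k))) :
    fderiv ℝ (fun c : P.Strategy × EuclideanSpace ℝ (Fin (P.m k)) ×
      EuclideanSpace ℝ (Fin (P.d k)) => P.gradLagrangian k c.1 c.2.1 c.2.2) (x, lam, w) (y, μ, 0) =
      ∑ i, P.hessLagrangian k i x lam w (y i) + ∑ i, μ i • P.gradConstraint k i (x k) w := by
  have h1 := ((P.contDiff_gradLagrangian k).differentiable (by norm_num) (x, lam, w)).hasFDerivAt
  set D := fderiv ℝ (fun c : P.Strategy × EuclideanSpace ℝ (Fin (P.m k)) ×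
      EuclideanSpace ℝ (Fin (P.d k)) => P.gradLagrangian k c.1 c.2.1 c.2.2) (x, lam, w) with hD
  have hx : ∀ i, D (Pi.single i (y i), 0) = P.hessLagrangian k i x lam w (y i) := by
    intro i
    have h2 := (hasFDerivAt_update (𝕜 := ℝ) x (x i)).prodMk
      (hasFDerivAt_const (lam, w) (x i))
    have h3 := HasFDerivAt.comp (x i) (by simpa using h1) h2
    unfold hessLagrangian
    have h4 : (ContinuousLinearMap.pi (Pi.single i (ContinuousLinearMap.id ℝ _)) :
        EuclideanSpace ℝ (Fin (P.n i)) →L[ℝ] P.Strategy) (y i) = Pi.single i (y i) := by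
      ext j : 1
      by_cases hj : j = i
      · subst hj; simp
      · simp [hj]
    rw [← h4]
    exact (congrArg (fun A => A (y i)) h3.fderiv).symm
  have hμ : D (0, μ, 0) = ∑ i, μ i • P.gradConstraint k i (x k) w := by
    have h2 : HasDerivAt (fun t : ℝ => (x, lam + t • μ, w)) (0, μ, 0) 0 := by
      refine (hasDerivAt_const _ _).prodMk (HasDerivAt.prodMk ?_ (hasDerivAt_const _ _))
      simpa using ((hasDerivAt_id (0 : ℝ)).smul_const μ).const_add lam
    have h3 := HasFDerivAt.comp_hasDerivAt (0 : ℝ) (by simpa using h1) h2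
    have h4 : HasDerivAt (fun t : ℝ => P.gradLagrangian k x (lam + t • μ) w)
        (∑ i, μ i • P.gradConstraint k i (x k) w) 0 := by
      simp only [gradLagrangian_add_multiplier]
      have : ∀ t : ℝ, ∑ i, (t • μ) i • P.gradConstraint k i (x k) w =
          t • ∑ i, μ i • P.gradConstraint k i (x k) w := fun t => by
        simp [Finset.smul_sum, mul_smul]
      simp only [this]
      simpa using ((hasDerivAt_id (0 : ℝ)).smul_const
        (∑ i, μ i • P.gradConstraint k i (x k) w)).const_add (P.gradLagrangian k x lam w)
    exact h3.unique h4
  -- Split the direction into single-player blocks and a pure multiplier part.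
  have hy : (y, μ, (0 : EuclideanSpace ℝ (Fin (P.d k)))) =
      ∑ i, ((Pi.single i (y i) : P.Strategy), (0 : EuclideanSpace ℝ (Fin (P.m k)) ×
        EuclideanSpace ℝ (Fin (P.d k)))) + (0, μ, 0) := by
    refine Prod.ext ?_ ?_
    · simp [Prod.fst_sum, Finset.univ_sum_single]
    · simp [Prod.snd_sum]
  rw [hy, map_add, map_sum, hμ]
  simp only [hx]

/-- The derivative of a constraint in the directions that leave the parameter fixed. -/
theorem fderiv_constraint_apply (i : Fin (P.m k)) (x y : EuclideanSpace ℝ (Fin (P.n k)))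
    (w : EuclideanSpace ℝ (Fin (P.d k))) :
    fderiv ℝ (fun c : EuclideanSpace ℝ (Fin (P.n k)) × EuclideanSpace ℝ (Fin (P.d k)) =>
      P.g k i c.1 c.2) (x, w) (y, 0) = ⟪P.gradConstraint k i x w, y⟫_ℝ := by
  have h1 := ((P.g_contDiff k i).differentiable (by norm_num) (x, w)).hasFDerivAt
  have h2 := HasFDerivAt.comp (f := fun z => (z, w)) x h1 ((hasFDerivAt_id x).prodMk (hasFDerivAt_const w x))
  rw [gradConstraint, inner_gradient_left]
  exact (congrArg (fun A => A y) h2.fderiv).symm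

/-! ### Multiplier directions under SMFCQ -/

/-- Under the strict Mangasarian-Fromovitz constraint qualification, multiplier directions that
annihilate the constraint gradients vanish. -/
theorem SMFCQ.eq_zero {pk : P.PlayerParam k} {xk : EuclideanSpace ℝ (Fin (P.n k))}
    {lamk μ : EuclideanSpace ℝ (Fin (P.m k))} (h : P.SMFCQ k pk xk lamk)
    (hsum : ∑ i, μ i • P.gradConstraint k i xk (wPart pk) = 0)
    (h2 : ∀ i ∈ P.I₂ k pk xk lamk, 0 ≤ μ i)
    (h3 : ∀ i, i ∉ P.I₁ k pk xk lamk → i ∉ P.I₂ k pk xk lamk → μ i = 0) : μ = 0 := by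
  classical
  obtain ⟨hli, z, hz1, hz2⟩ := h
  -- Pairing `hsum` with the SMFCQ vector z gives a zero sum of nonpositive terms. Each term
  -- vanishes, which forces μ = 0 on I₂; linear independence then handles I₁.
  have hterm : ∀ i, μ i * ⟪P.gradConstraint k i xk (wPart pk), z⟫_ℝ ≤ 0 := by
    intro i
    by_cases hi1 : i ∈ P.I₁ k pk xk lamk
    · simp [hz1 i hi1]
    by_cases hi2 : i ∈ P.I₂ k pk xk lamk
    · exact mul_nonpos_of_nonneg_of_nonpos (h2 i hi2) (hz2 i hi2).le
    · simp [h3 i hi1 hi2]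
  have hzero : ∑ i, μ i * ⟪P.gradConstraint k i xk (wPart pk), z⟫_ℝ = 0 := by
    have := congrArg (fun v => ⟪v, z⟫_ℝ) hsum
    simpa [sum_inner, real_inner_smul_left] using this
  have hout : ∀ i, i ∉ P.I₁ k pk xk lamk → μ i = 0 := by
    intro i hi1
    by_cases hi2 : i ∈ P.I₂ k pk xk lamk
    · have := (Finset.sum_eq_zero_iff_of_nonpos fun i _ => hterm i).1 hzero i (Finset.mem_univ i)
      exact (mul_eq_zero.1 this).resolve_right (hz2 i hi2).ne
    · exact h3 i hi1 hi2
  have hsub : ∑ i : P.I₁ k pk xk lamk, μ i • P.gradConstraint k i xk (wPart pk) = 0 := by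
    rw [← hsum, ← Finset.sum_subset (Finset.filter_subset (· ∈ P.I₁ k pk xk lamk) Finset.univ)
      fun i _ hi => by rw [hout i (by simpa using hi), zero_smul]]
    exact (Finset.sum_subtype (Finset.univ.filter (· ∈ P.I₁ k pk xk lamk)) (fun i => by simp)
      fun i => μ i • P.gradConstraint k i xk (wPart pk)).symm
  ext i
  by_cases hi1 : i ∈ P.I₁ k pk xk lamk
  · exact Fintype.linearIndependent_iff.1 hli (fun i => μ i) hsub ⟨i, hi1⟩
  · exact hout i hi1

end NEP

/-! ### Linearization of the KKT system -/

namespace NEP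

variable {N : ℕ} {P : NEP N}

/-- Tangent directions of the graph of the KKT mapping, with vanishing parameter component,
solve the linearized gradient equation. -/
theorem linearized_gradient_eq_zero {ι : Type*} {F : Filter ι} [F.NeBot] {pbar : P.Param}
    {zbar : P.Strategy × P.Multiplier} (hKKT : zbar ∈ P.SKKT pbar)
    {p : ι → P.Param} {z : ι → P.Strategy × P.Multiplier} {c : ι → ℝ}
    {η : P.Strategy × P.Multiplier} (hz : ∀ l, z l ∈ P.SKKT (p l))
    (hp : Tendsto p F (𝓝 pbar)) (hzb : Tendsto z F (𝓝 zbar))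
    (hpc : Tendsto (fun l => c l • (p l - pbar)) F (𝓝 0))
    (hzc : Tendsto (fun l => c l • (z l - zbar)) F (𝓝 η)) (k : Fin N) :
    ∑ i, P.hessLagrangian k i zbar.1 (zbar.2 k) (wPart (pbar k)) (η.1 i) +
      ∑ i, η.2 k i • P.gradConstraint k i (zbar.1 k) (wPart (pbar k)) = 0 := by
  have hpk := (tendsto_pi_nhds.1 hpc) k
  have hd := hzb.fst_nhds.prodMk_nhds
    ((tendsto_pi_nhds.1 hzb.snd_nhds k).prodMk_nhds (tendsto_pi_nhds.1 hp k).snd_nhds.snd_nhds)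
  have hcd := hzc.fst_nhds.prodMk_nhds
    ((tendsto_pi_nhds.1 hzc.snd_nhds k).prodMk_nhds hpk.snd_nhds.snd_nhds)
  have h1 := ((P.contDiff_gradLagrangian k).differentiable (by norm_num)
    (zbar.1, zbar.2 k, wPart (pbar k))).hasFDerivAt.tendsto_smul_sub (c := c) hd hcd
  have h2 : Tendsto (fun l => c l • (vPart (p l k) - vPart (pbar k))) F (𝓝 0) :=
    hpk.snd_nhds.fst_nhds
  -- The KKT equations turn the quotients of v^k into those of the Lagrangian gradient.
  simp only [(hz _ k).1, (hKKT k).1] at h2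
  rw [← fderiv_gradLagrangian_apply]
  exact tendsto_nhds_unique h1 h2

/-- The difference quotients of a constraint slack converge to the directional derivative. -/
theorem tendsto_smul_slack_sub {ι : Type*} {F : Filter ι} {pbar : P.Param}
    {zbar : P.Strategy × P.Multiplier}
    {p : ι → P.Param} {z : ι → P.Strategy × P.Multiplier} {c : ι → ℝ}
    {η : P.Strategy × P.Multiplier}
    (hp : Tendsto p F (𝓝 pbar)) (hzb : Tendsto z F (𝓝 zbar))
    (hpc : Tendsto (fun l => c l • (p l - pbar)) F (𝓝 0))
    (hzc : Tendsto (fun l => c l • (z l - zbar)) F (𝓝 η)) (k : Fin N) (i : Fin (P.m k)) :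
    Tendsto (fun l => c l * ((P.g k i ((z l).1 k) (wPart (p l k)) - uPart (p l k) i) -
      (P.g k i (zbar.1 k) (wPart (pbar k)) - uPart (pbar k) i))) F
      (𝓝 ⟪P.gradConstraint k i (zbar.1 k) (wPart (pbar k)), η.1 k⟫_ℝ) := by
  have hpk := (tendsto_pi_nhds.1 hpc) k
  have hd := (tendsto_pi_nhds.1 hzb.fst_nhds k).prodMk_nhds
    (tendsto_pi_nhds.1 hp k).snd_nhds.snd_nhds
  have hcd := (tendsto_pi_nhds.1 hzc.fst_nhds k).prodMk_nhds hpk.snd_nhds.snd_nhds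
  have h1 := ((P.g_contDiff k i).differentiable (by norm_num)
    (zbar.1 k, wPart (pbar k))).hasFDerivAt.tendsto_smul_sub (c := c) hd hcd
  have h2 : Tendsto (fun l => c l * (uPart (p l k) i - uPart (pbar k) i)) F (𝓝 0) :=
    ((EuclideanSpace.proj (𝕜 := ℝ) i).continuous.tendsto 0).comp hpk.fst_nhds
  have h3 := h1.sub h2
  rw [sub_zero] at h3
  rw [← fderiv_constraint_apply]
  refine h3.congr fun l => ?_
  simp only [smul_eq_mul]
  ring

/-- Tangent directions of the graph of the KKT mapping, with vanishing parameter component,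
satisfy the linearized complementarity conditions. -/
theorem linearized_complementarity {ι : Type*} {𝒰 : Ultrafilter ι} {pbar : P.Param}
    {zbar : P.Strategy × P.Multiplier} (hKKT : zbar ∈ P.SKKT pbar)
    {p : ι → P.Param} {z : ι → P.Strategy × P.Multiplier} {c : ι → ℝ}
    {η : P.Strategy × P.Multiplier} (hc : ∀ l, 0 < c l) (hz : ∀ l, z l ∈ P.SKKT (p l))
    (hp : Tendsto p 𝒰 (𝓝 pbar)) (hzb : Tendsto z 𝒰 (𝓝 zbar))
    (hpc : Tendsto (fun l => c l • (p l - pbar)) 𝒰 (𝓝 0))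
    (hzc : Tendsto (fun l => c l • (z l - zbar)) 𝒰 (𝓝 η)) (k : Fin N) (i : Fin (P.m k)) :
    (i ∈ P.I₁ k (pbar k) (zbar.1 k) (zbar.2 k) →
      ⟪P.gradConstraint k i (zbar.1 k) (wPart (pbar k)), η.1 k⟫_ℝ = 0) ∧
    (i ∈ P.I₂ k (pbar k) (zbar.1 k) (zbar.2 k) →
      ⟪P.gradConstraint k i (zbar.1 k) (wPart (pbar k)), η.1 k⟫_ℝ ≤ 0 ∧ 0 ≤ η.2 k i ∧
        (η.2 k i = 0 ∨ ⟪P.gradConstraint k i (zbar.1 k) (wPart (pbar k)), η.1 k⟫_ℝ = 0)) ∧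
    (i ∉ P.I₁ k (pbar k) (zbar.1 k) (zbar.2 k) → i ∉ P.I₂ k (pbar k) (zbar.1 k) (zbar.2 k) →
      η.2 k i = 0) := by
  have hslack := tendsto_smul_slack_sub hp hzb hpc hzc k i
  have hC := fun l => constraints_of_mem_SKKT (hz l) k i
  have hCbar := constraints_of_mem_SKKT hKKT k i
  have hlam : Tendsto (fun l => (z l).2 k i) 𝒰 (𝓝 (zbar.2 k i)) :=
    ((EuclideanSpace.proj (𝕜 := ℝ) i).continuous.tendsto _).comp
      (tendsto_pi_nhds.1 hzb.snd_nhds k)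
  have hmu : Tendsto (fun l => c l * ((z l).2 k i - zbar.2 k i)) 𝒰 (𝓝 (η.2 k i)) :=
    ((EuclideanSpace.proj (𝕜 := ℝ) i).continuous.tendsto _).comp
      (tendsto_pi_nhds.1 hzc.snd_nhds k)
  have hslack0 : P.g k i (zbar.1 k) (wPart (pbar k)) - uPart (pbar k) i = 0 →
      (∀ᶠ l in (𝒰 : Filter ι), i.val < P.s k ∨ 0 < (z l).2 k i) →
      ⟪P.gradConstraint k i (zbar.1 k) (wPart (pbar k)), η.1 k⟫_ℝ = 0 := fun h0 hev =>
    tendsto_nhds_unique_of_eventuallyEq hslack tendsto_const_nhds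
      (hev.mono fun l hl => by simp only; rw [(hC l).2.2 hl, h0]; simp)
  have hmu0 : zbar.2 k i = 0 → (∀ᶠ l in (𝒰 : Filter ι), (z l).2 k i = 0) → η.2 k i = 0 :=
    fun h0 hev => tendsto_nhds_unique_of_eventuallyEq hmu tendsto_const_nhds
      (hev.mono fun l hl => by simp only; rw [hl, h0]; simp)
  refine ⟨?_, ?_, ?_⟩
  · rintro (⟨_, hpos, h0⟩ | hs)
    · exact hslack0 h0 ((hlam.eventually_const_lt hpos).mono fun _ => .inr)
    · exact hslack0 (hCbar.2.2 (.inl hs)) (.of_forall fun _ => .inl hs)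
  · rintro ⟨hs, hl0, h0⟩
    refine ⟨le_of_tendsto hslack (.of_forall fun l => ?_),
      ge_of_tendsto hmu (.of_forall fun l => ?_), ?_⟩
    · rw [h0, sub_zero]
      exact mul_nonpos_of_nonneg_of_nonpos (hc l).le (hC l).2.1
    · rw [hl0, sub_zero]
      exact mul_nonneg (hc l).le ((hC l).1 hs)
    -- An ultrafilter decides between the two branches of complementarity: a positive multiplier
    -- keeps the constraint active, a zero one makes the multiplier quotient vanish.
    · rcases 𝒰.em fun l => 0 < (z l).2 k i with h | h
      · exact .inr (hslack0 h0 (h.mono fun _ => .inr))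
      · exact .inl (hmu0 hl0 (h.mono fun l hl => le_antisymm (not_lt.1 hl) ((hC l).1 hs)))
  · intro hi1 hi2
    have hs : P.s k ≤ i.val := not_lt.1 fun h => hi1 (.inr h)
    have hl0 : zbar.2 k i = 0 := le_antisymm
      (not_lt.1 fun h => hi1 (.inl ⟨hs, h, hCbar.2.2 (.inr h)⟩)) (hCbar.1 hs)
    -- The constraint is inactive at the reference point, hence also nearby by continuity, so nearby
    -- multipliers are zero.
    have hneg : P.g k i (zbar.1 k) (wPart (pbar k)) - uPart (pbar k) i < 0 :=
      lt_of_le_of_ne hCbar.2.1 fun h => hi2 ⟨hs, hl0, h⟩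
    have hcont : Tendsto (fun l => P.g k i ((z l).1 k) (wPart (p l k)) - uPart (p l k) i) 𝒰
        (𝓝 (P.g k i (zbar.1 k) (wPart (pbar k)) - uPart (pbar k) i)) :=
      (((P.g_contDiff k i).continuous.tendsto (zbar.1 k, wPart (pbar k))).comp
        ((tendsto_pi_nhds.1 hzb.fst_nhds k).prodMk_nhds
          (tendsto_pi_nhds.1 hp k).snd_nhds.snd_nhds)).sub
        (((EuclideanSpace.proj (𝕜 := ℝ) i).continuous.tendsto _).comp
          (tendsto_pi_nhds.1 hp k).fst_nhds)
    exact hmu0 hl0 ((hcont.eventually_lt_const hneg).mono fun l hl =>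
      le_antisymm (not_lt.1 fun h => hl.ne ((hC l).2.2 (.inr h))) ((hC l).1 hs))

end NEP

theorem mainTheorem4 {N : ℕ} (P : NEP N)
    (pbar : P.Param) (xbar : P.Strategy) (lambar : P.Multiplier)
    (hKKT : (xbar, lambar) ∈ P.SKKT pbar)
    (hSMFCQ : ∀ k, P.SMFCQ k (pbar k) (xbar k) (lambar k))
    (hI : P.IPropertyOn pbar xbar lambar
      (P.K pbar xbar
        (fun k => P.I₁ k (pbar k) (xbar k) (lambar k))
        (fun k => P.I₂ k (pbar k) (xbar k) (lambar k)))) :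
    IsolatedCalm P.SKKT pbar (xbar, lambar) := by
  refine isolatedCalm_of_forall_tangent_eq_zero hKKT ?_
  rintro 𝒰 p z c ⟨y, μ⟩ hc hz hp hzb hpc hzc
  have hgrad := NEP.linearized_gradient_eq_zero hKKT hz hp hzb hpc hzc
  have hcomp := NEP.linearized_complementarity hKKT hc hz hp hzb hpc hzc
  dsimp only at hgrad hcomp
  have hy : y = 0 := by
    refine hI y (fun k => ⟨fun i => (hcomp k i).1, fun i hi => ((hcomp k i).2.1 hi).1⟩) fun k => ?_
    -- Replaces the Hessian form by -∑ μ^k_i ∇g^k_i·y^k, which vanishes term by term.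
    rw [← inner_sum, eq_neg_of_add_eq_zero_left (hgrad k), inner_neg_right, inner_sum, neg_eq_zero]
    refine Finset.sum_eq_zero fun i _ => ?_
    rw [real_inner_smul_right, real_inner_comm, mul_eq_zero]
    by_cases hi1 : i ∈ P.I₁ k (pbar k) (xbar k) (lambar k)
    · exact .inr ((hcomp k i).1 hi1)
    by_cases hi2 : i ∈ P.I₂ k (pbar k) (xbar k) (lambar k)
    · exact ((hcomp k i).2.1 hi2).2.2
    · exact .inl ((hcomp k i).2.2 hi1 hi2)
  subst hy
  have hμ : μ = 0 := funext fun k => (hSMFCQ k).eq_zero (by simpa using hgrad k)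
    (fun i hi => ((hcomp k i).2.1 hi).2.1) fun i => (hcomp k i).2.2
  rw [hμ]
  rfl
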